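/- Let $S^1=\{z\in\mathbb C:|z|=1\}$ and let $f_{0,\infty}=(f_n)_{n\ge 0}$ be an equicontinuous sequence of orientation-preserving continuous maps $f_n:S^1\to S^1$, where $f$ is called orientation-preserving if it has a continuous nondecreasing lift $F:\mathbb R\to\mathbb R$ of degree one, i.e. $f(e^{2\pi i t})=e^{2\pi i F(t)}$ and $F(t+1)=F(t)+1$ for all $t\in\mathbb R$ (in particular, orientation-preserving homeomorphisms are allowed). For a sequence $g_{0,\infty}=(g_n)_{n\ge0}$ of self-maps of a metric space $(Y,\rho)$ and $\Lambda\subset Y$, put $g_0^0=\mathrm{id}$, $g_0^k=g_{k-1}\circ\cdots\circ g_0$, let $s_n(\epsilon,\Lambda,g_{0,\infty})$ be the maximal cardinality of a set $E\subset\Lambda$ such that any two distinct $x,y\in E$ satisfy $\rho(g_0^k(x),g_0^k(y))>\epsilon$ for some $0\le k\le n-1$, and let $$h(g_{0,\infty},\Lambda)=\lim_{\epsilon\to0^+}\limsup_{n\to\infty}\frac1n\log s_n(\epsilon,\Lambda,g_{0,\infty}).$$ Let $\mathcal K(S^1)$ be the space of nonempty compact subsets of $S^1$ with the Hausdorff metric,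 $\bar f_n(K)=f_n(K)$, and let $\mathcal C(S^1)\subset\mathcal K(S^1)$ be the set of subcontinua (nonempty compact connected subsets). Let $\mathcal F(S^1)$ be the space of upper semicontinuous functions $u:S^1\to[0,1]$ with the endograph metric, i.e. the Hausdorff distance between the endographs $\{(x,a)\in S^1\times[0,1]:u(x)\ge a\}$ in $S^1\times[0,1]$ with the maximum metric, and let $\tilde f_n(u)(x)=\sup_{z\in f_n^{-1}(x)}u(z)$ (equal to $0$ if $f_n^{-1}(x)=\emptyset$). Put $\widetilde{\mathcal C}(S^1)=\{\chi_K:K\in\mathcal C(S^1)\}\subset\mathcal F(S^1)$, where $\chi_K$ is the characteristic function of $K$. Then $\bar f_n(\mathcal C(S^1))\subset\mathcal C(S^1)$ and $\tilde f_n(\widetilde{\mathcal C}(S^1))\subset\widetilde{\mathcal C}(S^1)$ for all $n\ge0$, and $$h(\tilde f_{0,\infty},\widetilde{\mathcal C}(S^1))=h(\bar f_{0,\infty},\mathcal C(S^1))=h(f_{0,\infty},S^1)=0.$$ -/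

import Mathlib

open Set Filter Topology TopologicalSpace
open scoped unitInterval

noncomputable section

namespace NonautonomousSystem

/-! ### Topological entropy of a sequence of maps -/

/-- The orbit map `f_0^n = f_{n-1} ∘ ⋯ ∘ f_0` (with `f_0^0 = id`). -/
def orbitMap {X : Type*} (f : ℕ → X → X) : ℕ → X → X
  | 0 => id
  | n + 1 => f n ∘ orbitMap f n

/-- `E` is `(n, ε)`-separated: any two distinct points of `E` are more than `ε` apart at some
time `0 ≤ k ≤ n - 1`. -/
def IsSeparatedSet {X : Type*} [MetricSpace X] (f : ℕ → X → X) (n : ℕ) (ε : ℝ) (E : Set X) :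
    Prop :=
  ∀ x ∈ E, ∀ y ∈ E, x ≠ y → ∃ k < n, ε < dist (orbitMap f k x) (orbitMap f k y)

/-- The maximal cardinality `s_n(ε, Λ, f)` of an `(n, ε)`-separated subset of `Λ`. -/
def sepCard {X : Type*} [MetricSpace X] (f : ℕ → X → X) (Λ : Set X) (n : ℕ) (ε : ℝ) : ℕ∞ :=
  ⨆ (E : Set X) (_ : E ⊆ Λ) (_ : IsSeparatedSet f n ε E), E.encard

/-- The exponential growth rate `limsup_n (1/n) log s_n(ε, Λ, f)` at scale `ε`. -/
def entropyAt {X : Type*} [MetricSpace X] (f : ℕ → X → X) (Λ : Set X) (ε : ℝ) : EReal :=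
  limsup (fun n : ℕ => ENNReal.log ((sepCard f Λ n ε : ℕ∞) : ENNReal) / (n : EReal)) atTop

/-- The topological entropy `h(f, Λ) = lim_{ε → 0} limsup_n (1/n) log s_n(ε, Λ, f)`. The rate at
scale `ε` is antitone in `ε`, so that the limit is a supremum (see `tendsto_entropyAt`). -/
def topEntropy {X : Type*} [MetricSpace X] (f : ℕ → X → X) (Λ : Set X) : EReal :=
  ⨆ (ε : ℝ) (_ : 0 < ε), entropyAt f Λ ε

theorem sepCard_anti {X : Type*} [MetricSpace X] (f : ℕ → X → X) (Λ : Set X) (n : ℕ) :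
    Antitone (sepCard f Λ n) := by
  intro ε δ h
  refine iSup_mono fun E => iSup_mono fun _ => iSup_mono' fun hE => ⟨?_, le_rfl⟩
  intro x hx y hy hxy
  obtain ⟨k, hk, hd⟩ := hE x hx y hy hxy
  exact ⟨k, hk, h.trans_lt hd⟩

theorem entropyAt_anti {X : Type*} [MetricSpace X] (f : ℕ → X → X) (Λ : Set X) :
    Antitone (entropyAt f Λ) := by
  intro ε δ h
  refine limsup_le_limsup (Eventually.of_forall fun n => ?_)
  refine EReal.div_le_div_right_of_nonneg (by positivity) ?_
  exact ENNReal.log_monotone (ENat.toENNReal_mono (sepCard_anti f Λ n h))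

theorem tendsto_entropyAt {X : Type*} [MetricSpace X] (f : ℕ → X → X) (Λ : Set X) :
    Tendsto (entropyAt f Λ) (𝓝[>] 0) (𝓝 (topEntropy f Λ)) := by
  refine tendsto_order.2 ⟨fun a ha => ?_, fun a ha => ?_⟩
  · obtain ⟨ε, hε⟩ := lt_iSup_iff.1 ha
    obtain ⟨h0, h1⟩ := lt_iSup_iff.1 hε
    filter_upwards [Ioo_mem_nhdsGT h0] with δ hδ
    exact h1.trans_le (entropyAt_anti f Λ hδ.2.le)
  · filter_upwards [self_mem_nhdsWithin] with δ hδ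
    exact (le_iSup₂ (f := fun (ε : ℝ) (_ : 0 < ε) => entropyAt f Λ ε) δ hδ).trans_lt ha

/-! ### The hyperspace of nonempty compact sets

`NonemptyCompacts X` carries Mathlib's Hausdorff metric. -/

/-- The induced map `K ↦ f(K)` on nonempty compact sets. -/
def hyperMap {X : Type*} [MetricSpace X] (f : C(X, X)) :
    NonemptyCompacts X → NonemptyCompacts X :=
  NonemptyCompacts.map f f.continuous

/-- The hyperspace of subcontinua (nonempty compact connected subsets). -/
def continua (X : Type*) [MetricSpace X] : Set (NonemptyCompacts X) :=
  {K | IsConnected (K : Set X)}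

/-! ### Upper semicontinuous fuzzy sets -/

/-- The space of upper semicontinuous fuzzy sets `u : X → [0,1]`. -/
@[ext]
structure FuzzySet (X : Type*) [MetricSpace X] where
  /-- the membership function -/
  toFun : X → ℝ
  mem_Icc : ∀ x, toFun x ∈ Icc (0 : ℝ) 1
  usc : UpperSemicontinuous toFun

namespace FuzzySet

variable {X : Type*} [MetricSpace X]

/-- The endograph `{(x, a) ∈ X × [0,1] : u(x) ≥ a}`. -/
def endSet (u : FuzzySet X) : Set (X × I) :=
  {p | (p.2 : ℝ) ≤ u.toFun p.1}

theorem isClosed_endSet (u : FuzzySet X) : IsClosed u.endSet := by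
  have h := (upperSemicontinuousOn_iff_isClosed_hypograph isClosed_univ).1
    (upperSemicontinuousOn_univ_iff.2 u.usc)
  simp only [mem_univ, true_and] at h
  exact h.preimage (f := fun p : X × I => (p.1, (p.2 : ℝ))) (by fun_prop)

theorem endSet_nonempty [Nonempty X] (u : FuzzySet X) : u.endSet.Nonempty :=
  ⟨(Classical.arbitrary X, 0), by simpa [endSet] using (u.mem_Icc _).1⟩

/-- The endograph as a nonempty compact subset of `X × [0,1]`. -/
def endograph [CompactSpace X] [Nonempty X] (u : FuzzySet X) : NonemptyCompacts (X × I) :=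
  ⟨⟨u.endSet, u.isClosed_endSet.isCompact⟩, u.endSet_nonempty⟩

theorem endograph_injective [CompactSpace X] [Nonempty X] :
    Function.Injective (endograph (X := X)) := by
  intro u v h
  have h' : u.endSet = v.endSet :=
    congrArg (fun K : NonemptyCompacts (X × I) => K.toCompacts.carrier) h
  ext x
  apply le_antisymm
  · have : (x, (⟨u.toFun x, u.mem_Icc x⟩ : I)) ∈ v.endSet := h' ▸ (le_refl (u.toFun x))
    exact this
  · have : (x, (⟨v.toFun x, v.mem_Icc x⟩ : I)) ∈ u.endSet := h' ▸ (le_refl (v.toFun x))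
    exact this

/-- The endograph metric `d_E(u, v) = D_{X × I}(end u, end v)`, where `D` is the Hausdorff metric
and `X × I` has the maximum metric. The endograph of the empty fuzzy set `0` is `X × {0}`, so the
same formula gives `d_E(0, u) = sup u`, as does the Hausdorff distance taken in `supp u × I`. -/
instance [CompactSpace X] [Nonempty X] : MetricSpace (FuzzySet X) :=
  MetricSpace.induced endograph endograph_injective inferInstance

/-- The values of Zadeh's extension: `sup_{f(z) = x} u(z)`, and `0` off the range of `f`. -/
def zadehFun (f : X → X) (u : X → ℝ) (x : X) : ℝ :=
  open Classical in
  if (f ⁻¹' {x}).Nonempty then sSup (u '' (f ⁻¹' {x})) else 0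

theorem zadehFun_mem_Icc (f : X → X) (u : FuzzySet X) (x : X) :
    zadehFun f u.toFun x ∈ Icc (0 : ℝ) 1 := by
  unfold zadehFun
  split_ifs
  · refine ⟨Real.sSup_nonneg ?_, Real.sSup_le ?_ zero_le_one⟩
    · rintro _ ⟨z, -, rfl⟩
      exact (u.mem_Icc z).1
    · rintro _ ⟨z, -, rfl⟩
      exact (u.mem_Icc z).2
  · simp

theorem zadehFun_usc [CompactSpace X] (f : C(X, X)) (u : FuzzySet X) :
    UpperSemicontinuous (zadehFun f u.toFun) := by
  rw [upperSemicontinuous_iff_isClosed_preimage]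
  intro a
  by_cases ha : a ≤ 0
  · convert isClosed_univ
    exact eq_univ_of_forall fun x => ha.trans (zadehFun_mem_Icc f u x).1
  · have key : zadehFun f u.toFun ⁻¹' Ici a = f '' (u.toFun ⁻¹' Ici a) := by
      ext x
      constructor
      · intro hx
        simp only [mem_preimage, mem_Ici, zadehFun] at hx
        split_ifs at hx with hne
        · have hc : IsCompact (f ⁻¹' {x}) := (isClosed_singleton.preimage f.continuous).isCompact
          obtain ⟨z, hz, hmax⟩ :=
            (u.usc.upperSemicontinuousOn (f ⁻¹' {x})).exists_isMaxOn hne hc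
          refine ⟨z, ?_, hz⟩
          refine hx.trans (csSup_le (hne.image _) ?_)
          rintro _ ⟨w, hw, rfl⟩
          exact hmax hw
        · exact absurd hx ha
      · rintro ⟨z, hz, rfl⟩
        have hne : (f ⁻¹' {f z}).Nonempty := ⟨z, rfl⟩
        simp only [mem_preimage, mem_Ici, zadehFun, if_pos hne]
        refine le_trans hz (le_csSup ⟨1, ?_⟩ ⟨z, rfl, rfl⟩)
        rintro _ ⟨w, -, rfl⟩
        exact (u.mem_Icc w).2
    rw [key]
    exact ((u.usc.isClosed_preimage a).isCompact.image f.continuous).isClosed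

/-- Zadeh's extension of a continuous self-map of `X` to fuzzy sets. -/
def zadeh [CompactSpace X] (f : C(X, X)) (u : FuzzySet X) : FuzzySet X :=
  ⟨zadehFun f u.toFun, zadehFun_mem_Icc f u, zadehFun_usc f u⟩

/-- The characteristic function `χ_K` of a nonempty compact set. -/
def char (K : NonemptyCompacts X) : FuzzySet X where
  toFun := indicator (K : Set X) 1
  mem_Icc x := by
    by_cases h : x ∈ (K : Set X) <;> simp [h]
  usc := K.isCompact.isClosed.upperSemicontinuous_indicator zero_le_one

end FuzzySet

/-- The set `{χ_K : K a subcontinuum of X}` of fuzzy sets. -/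
def fuzzyContinua (X : Type*) [MetricSpace X] : Set (FuzzySet X) :=
  FuzzySet.char '' continua X

/-! ### Orientation-preserving circle maps -/

/-- A self-map `f` of the unit circle is orientation preserving if it has a continuous
nondecreasing lift `F : ℝ → ℝ` of degree one: `f(e^{2πit}) = e^{2πi F(t)}` and
`F(t + 1) = F(t) + 1`. -/
def OrientationPreserving (f : Circle → Circle) : Prop :=
  ∃ F : ℝ → ℝ, Continuous F ∧ Monotone F ∧ (∀ t, F (t + 1) = F t + 1) ∧
    ∀ t, f (Circle.exp (2 * Real.pi * t)) = Circle.exp (2 * Real.pi * F t)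

end NonautonomousSystem

end

namespace NonautonomousSystem

/-! ### General facts on entropy -/

section Entropy

variable {X Y : Type*} [MetricSpace X] [MetricSpace Y]

/-! Every entropy over a nonempty set is nonnegative, since singletons are separated. Singletons
embed the circle isometrically into its continua, and `K ↦ χ_K` is a 1-Lipschitz semiconjugacy onto
the fuzzy continua, so it suffices that the entropy on continua is at most zero.

A subcontinuum is an arc with lifted endpoints `a ≤ b` in `[0, 2]` (`exists_eq_arc`), and its image
at time `k` is the arc from `G k a` to `G k b`, with `G k` a monotone degree-one lift of the orbit
map (`image_arc`). The itinerary `k ↦ ⌊N * G k t⌋`, `k < n`, is monotone in `t` in each entry, so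
equal sums force equal itineraries; by degree one the sum takes at most `2Nn + 1` values on `[0,
2]`. Two endpoints thus give at most `(2Nn + 1)^2` distinguishable arcs (`sepCard_continua_le`), and
quadratic growth has exponential rate zero. -/

theorem one_le_sepCard (f : ℕ → X → X) {Λ : Set X} (h : Λ.Nonempty) (n : ℕ) (ε : ℝ) :
    1 ≤ sepCard f Λ n ε := by
  obtain ⟨x, hx⟩ := h
  have hs : IsSeparatedSet f n ε {x} := by
    rintro a rfl b rfl hab
    exact absurd rfl hab
  rw [← encard_singleton x]
  exact le_iSup_of_le {x} (le_iSup_of_le (singleton_subset_iff.2 hx) (le_iSup_of_le hs le_rfl))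

theorem topEntropy_nonneg (f : ℕ → X → X) {Λ : Set X} (h : Λ.Nonempty) :
    0 ≤ topEntropy f Λ := by
  refine le_trans ?_ (le_iSup₂ (f := fun (ε : ℝ) (_ : 0 < ε) => entropyAt f Λ ε) 1 one_pos)
  refine le_limsup_of_frequently_le' (Frequently.of_forall fun n => ?_)
  refine EReal.div_nonneg ?_ (by positivity)
  rw [ENNReal.zero_le_log_iff]
  simpa using ENat.toENNReal_mono (one_le_sepCard f h n 1)

theorem tendsto_log_sq_div (C : ℝ) (hC : 0 < C) :
    Tendsto (fun n : ℕ => Real.log ((C * n) ^ 2) / n) atTop (𝓝 0) := by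
  have h1 : Tendsto (fun n : ℕ => Real.log n / (n : ℝ)) atTop (𝓝 0) :=
    Real.isLittleO_log_id_atTop.tendsto_div_nhds_zero.comp tendsto_natCast_atTop_atTop
  have h2 : Tendsto (fun n : ℕ => 2 * Real.log C / (n : ℝ)) atTop (𝓝 0) :=
    tendsto_const_div_atTop_nhds_zero_nat _
  have h3 := h2.add (h1.const_mul 2)
  simp only [mul_zero, add_zero] at h3
  refine h3.congr' ?_
  filter_upwards [eventually_gt_atTop 0] with n hn
  have hn' : (0 : ℝ) < n := by exact_mod_cast hn
  rw [Real.log_pow, Real.log_mul hC.ne' hn'.ne']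
  push_cast
  ring

/-- A sequence whose separated sets have at most quadratic cardinality has entropy at most `0`. -/
theorem topEntropy_nonpos_of_sepCard_le (f : ℕ → X → X) (Λ : Set X)
    (h : ∀ ε : ℝ, 0 < ε → ∃ C : ℕ, 0 < C ∧
      ∀ n : ℕ, 0 < n → sepCard f Λ n ε ≤ (((C * n) ^ 2 : ℕ) : ℕ∞)) :
    topEntropy f Λ ≤ 0 := by
  refine iSup₂_le fun ε hε => ?_
  obtain ⟨C, hC, hb⟩ := h ε hε
  have hC' : (0 : ℝ) < C := by exact_mod_cast hC
  have ht : Tendsto (fun n : ℕ => ((Real.log ((C * n) ^ 2) / n : ℝ) : EReal)) atTop (𝓝 0) :=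
    (continuous_coe_real_ereal.tendsto 0).comp (tendsto_log_sq_div C hC')
  rw [← ht.limsup_eq]
  refine limsup_le_limsup ?_
  filter_upwards [eventually_gt_atTop 0] with n hn
  have hn' : (0 : ℝ) < n := by exact_mod_cast hn
  have hpos : (0 : ℝ) < (C * n : ℝ) ^ 2 := by positivity
  rw [EReal.coe_div, ← ENNReal.log_ofReal_of_pos hpos]
  refine EReal.div_le_div_right_of_nonneg (by positivity) (ENNReal.log_monotone ?_)
  refine (ENat.toENNReal_mono (hb n hn)).trans_eq ?_
  rw [ENat.toENNReal_coe, ← ENNReal.ofReal_natCast]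
  push_cast
  rfl

/-- Separated sets transport along a map that does not shrink distances along orbits. -/
theorem sepCard_le_of_dist_le (f : ℕ → X → X) (g : ℕ → Y → Y) {Λ : Set X} {Λ' : Set Y}
    (ψ : Y → X) (hψ : MapsTo ψ Λ' Λ)
    (hd : ∀ k, ∀ y ∈ Λ', ∀ y' ∈ Λ',
      dist (orbitMap g k y) (orbitMap g k y') ≤ dist (orbitMap f k (ψ y)) (orbitMap f k (ψ y')))
    (n : ℕ) (ε : ℝ) : sepCard g Λ' n ε ≤ sepCard f Λ n ε := by
  refine iSup_le fun E => iSup₂_le fun hE hs => ?_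
  -- Time `k = 0`, where the orbit map is the identity, already makes `ψ` injective.
  have hinj : InjOn ψ E := by
    intro y hy y' hy' h
    have := hd 0 y (hE hy) y' (hE hy')
    rw [h, dist_self] at this
    exact dist_le_zero.1 this
  have hs' : IsSeparatedSet f n ε (ψ '' E) := by
    rintro _ ⟨y, hy, rfl⟩ _ ⟨y', hy', rfl⟩ hne
    obtain ⟨k, hk, hlt⟩ := hs y hy y' hy' (fun h => hne (congrArg ψ h))
    exact ⟨k, hk, hlt.trans_le (hd k y (hE hy) y' (hE hy'))⟩
  rw [← hinj.encard_image]
  exact le_iSup_of_le (ψ '' E)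
    (le_iSup_of_le ((hψ.mono_left hE).image_subset) (le_iSup_of_le hs' le_rfl))

theorem topEntropy_le_of_dist_le (f : ℕ → X → X) (g : ℕ → Y → Y) {Λ : Set X} {Λ' : Set Y}
    (ψ : Y → X) (hψ : MapsTo ψ Λ' Λ)
    (hd : ∀ k, ∀ y ∈ Λ', ∀ y' ∈ Λ',
      dist (orbitMap g k y) (orbitMap g k y') ≤ dist (orbitMap f k (ψ y)) (orbitMap f k (ψ y'))) :
    topEntropy g Λ' ≤ topEntropy f Λ := by
  refine iSup₂_mono fun ε _ => limsup_le_limsup (Eventually.of_forall fun n => ?_)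
  refine EReal.div_le_div_right_of_nonneg (by positivity) (ENNReal.log_monotone ?_)
  exact ENat.toENNReal_mono (sepCard_le_of_dist_le f g ψ hψ hd n ε)

end Entropy

theorem orbitMap_semiconj {X Y : Type*} (f : ℕ → X → X) (g : ℕ → Y → Y) (φ : X → Y)
    (h : ∀ n x, g n (φ x) = φ (f n x)) (k : ℕ) (x : X) :
    orbitMap g k (φ x) = φ (orbitMap f k x) := by
  induction k with
  | zero => rfl
  | succ k ih => simp only [orbitMap, Function.comp_apply, ih, h]

/-! ### Induced maps on compact sets and on fuzzy sets -/

section Induced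

variable {X : Type*} [MetricSpace X]

theorem mapsTo_hyperMap_continua (f : C(X, X)) :
    MapsTo (hyperMap f) (continua X) (continua X) := by
  intro K hK
  change IsConnected ((NonemptyCompacts.map f f.continuous K : NonemptyCompacts X) : Set X)
  rw [NonemptyCompacts.coe_map]
  exact IsConnected.image hK f f.continuous.continuousOn

theorem hyperMap_singleton (f : C(X, X)) (x : X) :
    hyperMap f {x} = ({f x} : NonemptyCompacts X) :=
  NonemptyCompacts.map_singleton f.continuous x

theorem coe_orbitMap_hyperMap (f : ℕ → C(X, X)) (k : ℕ) (K : NonemptyCompacts X) :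
    ((orbitMap (fun n => hyperMap (f n)) k K : NonemptyCompacts X) : Set X) =
      orbitMap (fun n => (f n : X → X)) k '' K := by
  induction k with
  | zero => simp [orbitMap]
  | succ k ih =>
    simp only [orbitMap, Function.comp_apply, image_comp, ← ih]
    exact NonemptyCompacts.coe_map (f k).continuous _

theorem topEntropy_le_topEntropy_hyperMap (f : ℕ → C(X, X)) :
    topEntropy (fun n => (f n : X → X)) univ ≤
      topEntropy (fun n => hyperMap (f n)) (continua X) := by
  refine topEntropy_le_of_dist_le _ _ (fun x => ({x} : NonemptyCompacts X)) ?_ ?_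
  · intro x _
    simpa [continua] using isConnected_singleton (x := x)
  · intro k x _ y _
    rw [orbitMap_semiconj (fun n => (f n : X → X)) (fun n => hyperMap (f n))
        (fun x => ({x} : NonemptyCompacts X)) (fun n x => hyperMap_singleton (f n) x),
      orbitMap_semiconj (fun n => (f n : X → X)) (fun n => hyperMap (f n))
        (fun x => ({x} : NonemptyCompacts X)) (fun n x => hyperMap_singleton (f n) x)]
    exact (NonemptyCompacts.isometry_singleton.dist_eq _ _).ge

namespace FuzzySet

theorem char_apply_of_mem {K : NonemptyCompacts X} {x : X} (h : x ∈ (K : Set X)) :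
    (char K).toFun x = 1 := by
  simp [char, h]

theorem char_apply_of_notMem {K : NonemptyCompacts X} {x : X} (h : x ∉ (K : Set X)) :
    (char K).toFun x = 0 := by
  simp [char, h]

/-- A point over `K` moves horizontally, at fixed height, to a nearest point of `L`. A point off `K`
has height 0 and so lies in every endograph. -/
theorem exists_mem_endSet_char_dist_le (K L : NonemptyCompacts X) {p : X × I}
    (hp : p ∈ (char K).endSet) : ∃ q ∈ (char L).endSet, dist p q ≤ dist K L := by
  by_cases hx : p.1 ∈ (K : Set X)
  · obtain ⟨y, hy, hxy⟩ := L.isCompact.exists_infDist_eq_dist L.nonempty p.1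
    refine ⟨(y, p.2), ?_, ?_⟩
    · change (p.2 : ℝ) ≤ (char L).toFun y
      rw [char_apply_of_mem hy]
      exact p.2.2.2
    · rw [Prod.dist_eq, dist_self, max_eq_left dist_nonneg, ← hxy, Metric.NonemptyCompacts.dist_eq]
      exact Metric.infDist_le_hausdorffDist_of_mem hx
        (Metric.hausdorffEDist_ne_top_of_nonempty_of_bounded K.nonempty L.nonempty
          K.isCompact.isBounded L.isCompact.isBounded)
  · refine ⟨p, ?_, by rw [dist_self]; exact dist_nonneg⟩
    have h0 : (p.2 : ℝ) ≤ (char K).toFun p.1 := hp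
    rw [char_apply_of_notMem hx] at h0
    exact h0.trans ((char L).mem_Icc p.1).1

variable [CompactSpace X]

theorem zadeh_char (f : C(X, X)) (K : NonemptyCompacts X) :
    zadeh f (char K) = char (hyperMap f K) := by
  have hcoe : (hyperMap f K : Set X) = f '' K := NonemptyCompacts.coe_map f.continuous K
  ext x
  change zadehFun f (char K).toFun x = _
  unfold zadehFun
  by_cases hx : x ∈ f '' (K : Set X)
  · obtain ⟨z, hz, rfl⟩ := hx
    rw [char_apply_of_mem (hcoe ▸ mem_image_of_mem f hz), if_pos ⟨z, rfl⟩]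
    refine IsGreatest.csSup_eq ⟨⟨z, rfl, char_apply_of_mem hz⟩, ?_⟩
    rintro _ ⟨w, -, rfl⟩
    exact ((char K).mem_Icc w).2
  · rw [char_apply_of_notMem (hcoe ▸ hx)]
    split_ifs with hne
    · obtain ⟨z, hz⟩ := hne
      have h0 : ∀ w ∈ f ⁻¹' {x}, (char K).toFun w = 0 := fun w hw =>
        char_apply_of_notMem fun hwK => hx ⟨w, hwK, hw⟩
      refine IsGreatest.csSup_eq ⟨⟨z, hz, h0 z hz⟩, ?_⟩
      rintro _ ⟨w, hw, rfl⟩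
      exact (h0 w hw).le
    · rfl

variable [Nonempty X]

theorem dist_char_le (K L : NonemptyCompacts X) : dist (char K) (char L) ≤ dist K L := by
  change dist (endograph (char K)) (endograph (char L)) ≤ _
  rw [Metric.NonemptyCompacts.dist_eq]
  refine Metric.hausdorffDist_le_of_mem_dist dist_nonneg ?_ ?_
  · exact fun p hp => exists_mem_endSet_char_dist_le K L hp
  · intro p hp
    rw [dist_comm K L]
    exact exists_mem_endSet_char_dist_le L K hp

end FuzzySet

variable [CompactSpace X]

theorem mapsTo_zadeh_fuzzyContinua (f : C(X, X)) :
    MapsTo (FuzzySet.zadeh f) (fuzzyContinua X) (fuzzyContinua X) := by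
  rintro _ ⟨K, hK, rfl⟩
  exact ⟨hyperMap f K, mapsTo_hyperMap_continua f hK, (FuzzySet.zadeh_char f K).symm⟩

theorem topEntropy_zadeh_le_topEntropy_hyperMap [Nonempty X] (f : ℕ → C(X, X)) :
    topEntropy (fun n => FuzzySet.zadeh (f n)) (fuzzyContinua X) ≤
      topEntropy (fun n => hyperMap (f n)) (continua X) := by
  have : Nonempty (NonemptyCompacts X) := ⟨{Classical.arbitrary X}⟩
  have hinv : ∀ u ∈ fuzzyContinua X,
      Function.invFunOn FuzzySet.char (continua X) u ∈ continua X ∧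
        FuzzySet.char (Function.invFunOn FuzzySet.char (continua X) u) = u :=
    fun u hu => Function.invFunOn_pos hu
  -- Any choice of a continuum representing `u` will do; injectivity of `char` plays no role.
  refine topEntropy_le_of_dist_le _ _ (Function.invFunOn FuzzySet.char (continua X))
    (fun u hu => (hinv u hu).1) ?_
  intro k u hu v hv
  have hsemi := orbitMap_semiconj (fun n => hyperMap (f n)) (fun n => FuzzySet.zadeh (f n))
    FuzzySet.char (fun n K => FuzzySet.zadeh_char (f n) K) k
  conv_lhs => rw [← (hinv u hu).2, ← (hinv v hv).2, hsemi, hsemi]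
  exact FuzzySet.dist_char_le _ _

end Induced

/-! ### Arcs of the circle -/

theorem dist_circleExp_le (x y : ℝ) :
    dist (Circle.exp (2 * Real.pi * x)) (Circle.exp (2 * Real.pi * y)) ≤
      2 * Real.pi * |x - y| := by
  have h : Circle.exp (2 * Real.pi * x) =
      Circle.exp (2 * Real.pi * (x - y)) * Circle.exp (2 * Real.pi * y) := by
    rw [← Circle.exp_add]
    congr 1
    ring
  change dist (Circle.exp (2 * Real.pi * x) : ℂ) (Circle.exp (2 * Real.pi * y) : ℂ) ≤ _
  rw [Complex.dist_eq, h, Circle.coe_mul,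
    show ∀ a b : ℂ, a * b - b = (a - 1) * b from fun a b => by ring, norm_mul, Circle.norm_coe,
    mul_one, Circle.coe_exp, mul_comm _ Complex.I]
  refine Real.norm_exp_I_mul_ofReal_sub_one_le.trans_eq ?_
  rw [Real.norm_eq_abs, abs_mul, abs_of_pos Real.two_pi_pos]

theorem circleExp_add_int (t : ℝ) (m : ℤ) :
    Circle.exp (2 * Real.pi * (t + m)) = Circle.exp (2 * Real.pi * t) := by
  rw [mul_add, Circle.exp_add, Circle.exp_two_pi_mul_int, mul_one]

/-- The arc of the circle parametrized by `[a, b]`, with the full turn of length `1`. -/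
def arc (a b : ℝ) : Set Circle :=
  (fun t : ℝ => Circle.exp (2 * Real.pi * t)) '' Icc a b

theorem arc_add_int (a b : ℝ) (m : ℤ) : arc (a + m) (b + m) = arc a b := by
  unfold arc
  rw [← image_add_const_Icc, image_image]
  simp only [circleExp_add_int]

theorem arc_zero_one : arc 0 1 = univ := by
  refine eq_univ_of_forall fun z => ?_
  obtain ⟨t, rfl⟩ := Circle.exp_surjective z
  refine ⟨Int.fract (t / (2 * Real.pi)), ⟨Int.fract_nonneg _, (Int.fract_lt_one _).le⟩, ?_⟩
  change Circle.exp (2 * Real.pi * Int.fract (t / (2 * Real.pi))) = _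
  rw [← circleExp_add_int _ ⌊t / (2 * Real.pi)⌋, Int.fract_add_floor,
    mul_div_cancel₀ _ Real.two_pi_pos.ne']

theorem hausdorffDist_arc_le {a b c d δ : ℝ} (hab : a ≤ b) (hcd : c ≤ d)
    (hac : |a - c| ≤ δ) (hbd : |b - d| ≤ δ) :
    Metric.hausdorffDist (arc a b) (arc c d) ≤ 2 * Real.pi * δ := by
  have key : ∀ {a b c d : ℝ}, c ≤ d → |a - c| ≤ δ → |b - d| ≤ δ → ∀ x ∈ arc a b,
      ∃ y ∈ arc c d, dist x y ≤ 2 * Real.pi * δ := by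
    rintro a b c d hcd hac hbd _ ⟨x, ⟨hax, hxb⟩, rfl⟩
    rw [abs_le] at hac hbd
    -- The partner of `x` is its clamp to `[c, d]`, which moves it by at most the displacement of an
    -- endpoint.
    have hδ : |x - max c (min x d)| ≤ δ := by
      rw [abs_le]
      rcases le_total x d with h | h
      · rw [min_eq_left h]
        rcases le_total c x with h' | h'
        · rw [max_eq_right h']; constructor <;> linarith
        · rw [max_eq_left h']; constructor <;> linarith
      · rw [min_eq_right h, max_eq_right hcd]; constructor <;> linarith
    exact ⟨_, ⟨max c (min x d), ⟨le_max_left _ _, max_le hcd (min_le_right _ _)⟩, rfl⟩,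
      (dist_circleExp_le _ _).trans (mul_le_mul_of_nonneg_left hδ Real.two_pi_pos.le)⟩
  refine Metric.hausdorffDist_le_of_mem_dist
    (mul_nonneg Real.two_pi_pos.le ((abs_nonneg _).trans hac)) (key hcd hac hbd) ?_
  exact key hab (by rwa [abs_sub_comm]) (by rwa [abs_sub_comm])

/-- A connected compact proper subset of the circle is an arc of length at most one turn. -/
theorem exists_eq_arc_of_notMem {K : Set Circle} (hc : IsCompact K) (hK : IsConnected K)
    {p : Circle} (hp : p ∉ K) : ∃ a b : ℝ, a ≤ b ∧ b ≤ a + 1 ∧ K = arc a b := by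
  obtain ⟨s, hs⟩ := Circle.exp_surjective (-p)
  -- An angle in turns with its branch cut at `p`: the cut of `arg` is at `-1`, and `z / (-p) = -1`
  -- exactly when `z = p`. Adding `s` undoes the rotation.
  let g : Circle → ℝ := fun z => (Complex.arg ((z / (-p) : Circle) : ℂ) + s) / (2 * Real.pi)
  have hgexp : ∀ z, Circle.exp (2 * Real.pi * g z) = z := by
    intro z
    simp only [g]
    rw [mul_div_cancel₀ _ Real.two_pi_pos.ne', Circle.exp_add, Circle.exp_arg, hs, div_mul_cancel]
  have hgcont : ContinuousOn g K := by
    intro z hz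
    have hslit : ((z / (-p) : Circle) : ℂ) ∈ Complex.slitPlane := by
      rw [Complex.mem_slitPlane_iff_arg]
      refine ⟨fun h => hp ?_, Circle.coe_ne_zero _⟩
      have h1 : z / (-p) = -1 := by
        rw [← Circle.exp_arg (z / (-p)), h]
        ext
        simp
      have h2 : z = p := by
        rw [div_eq_iff_eq_mul] at h1
        simpa using h1
      exact h2 ▸ hz
    have hdiv : Continuous fun z : Circle => ((z / (-p) : Circle) : ℂ) :=
      by fun_prop
    exact ((((Complex.continuousAt_arg hslit).comp (f := fun z : Circle =>
      ((z / (-p) : Circle) : ℂ)) hdiv.continuousAt).add_const s).div_const _).continuousWithinAt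
  have hIcc := eq_Icc_of_connected_compact (hK.image g hgcont) (hc.image_of_continuousOn hgcont)
  set a := sInf (g '' K)
  set b := sSup (g '' K)
  have hab : a ≤ b := by
    rw [← nonempty_Icc, ← hIcc]
    exact hK.nonempty.image g
  refine ⟨a, b, hab, ?_, ?_⟩
  · obtain ⟨x, -, hx⟩ : a ∈ g '' K := hIcc ▸ left_mem_Icc.2 hab
    obtain ⟨y, -, hy⟩ : b ∈ g '' K := hIcc ▸ right_mem_Icc.2 hab
    rw [← hx, ← hy]
    simp only [g]
    rw [div_add_one Real.two_pi_pos.ne', div_le_div_iff_of_pos_right Real.two_pi_pos]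
    linarith [Complex.neg_pi_lt_arg ((x / (-p) : Circle) : ℂ),
      Complex.arg_le_pi ((y / (-p) : Circle) : ℂ)]
  · rw [arc, ← hIcc, image_image]
    simp only [hgexp, image_id']

/-- An integer shift brings `a` into `[0, 1)`, and `b ≤ a + 1` then gives `b ≤ 2`. -/
theorem exists_eq_arc {K : Set Circle} (hc : IsCompact K) (hK : IsConnected K) :
    ∃ a b : ℝ, 0 ≤ a ∧ a ≤ b ∧ b ≤ 2 ∧ K = arc a b := by
  by_cases hu : K = univ
  · exact ⟨0, 1, le_rfl, zero_le_one, one_le_two, hu.trans arc_zero_one.symm⟩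
  · obtain ⟨p, hp⟩ := (ne_univ_iff_exists_notMem K).1 hu
    obtain ⟨a, b, hab, hba, rfl⟩ := exists_eq_arc_of_notMem hc hK hp
    refine ⟨a + (-⌊a⌋ : ℤ), b + (-⌊a⌋ : ℤ), ?_, by linarith, ?_, (arc_add_int a b _).symm⟩
    · push_cast
      linarith [Int.floor_le a]
    · push_cast
      linarith [Int.lt_floor_add_one a]

/-! ### Lifts along the orbit -/

theorem OrientationPreserving.id : OrientationPreserving id :=
  ⟨_root_.id, continuous_id, monotone_id, fun _ => rfl, fun _ => rfl⟩

theorem OrientationPreserving.comp {f g : Circle → Circle} (hf : OrientationPreserving f)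
    (hg : OrientationPreserving g) : OrientationPreserving (f ∘ g) := by
  obtain ⟨F, hFc, hFm, hF1, hF⟩ := hf
  obtain ⟨G, hGc, hGm, hG1, hG⟩ := hg
  refine ⟨F ∘ G, hFc.comp hGc, hFm.comp hGm, fun t => ?_, fun t => ?_⟩
  · simp [hG1, hF1]
  · simp [hG, hF]

theorem OrientationPreserving.orbitMap {f : ℕ → Circle → Circle}
    (h : ∀ n, OrientationPreserving (f n)) (k : ℕ) :
    OrientationPreserving (NonautonomousSystem.orbitMap f k) := by
  induction k with
  | zero => exact .id
  | succ k ih => exact (h k).comp ih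

theorem image_arc {f : Circle → Circle} {F : ℝ → ℝ} (hc : Continuous F) (hm : Monotone F)
    (hF : ∀ t, f (Circle.exp (2 * Real.pi * t)) = Circle.exp (2 * Real.pi * F t))
    {a b : ℝ} (hab : a ≤ b) : f '' arc a b = arc (F a) (F b) := by
  unfold arc
  rw [← hc.continuousOn.image_Icc_of_monotoneOn hab (hm.monotoneOn _), image_image, image_image]
  simp only [hF]

/-! ### Counting itineraries of monotone lifts -/

/-- The sum over times `k < n` of the index of the cell of length `1 / N` that contains `G k t`. -/
noncomputable def cellSum (G : ℕ → ℝ → ℝ) (N n : ℕ) (t : ℝ) : ℤ :=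
  ∑ k ∈ Finset.range n, ⌊N * G k t⌋

section CellSum

variable {G : ℕ → ℝ → ℝ} (hm : ∀ k, Monotone (G k))
include hm

theorem floor_mul_monotone (N k : ℕ) : Monotone fun t => ⌊N * G k t⌋ := fun _ _ h =>
  Int.floor_mono (mul_le_mul_of_nonneg_left (hm k h) N.cast_nonneg)

theorem cellSum_monotone (N n : ℕ) : Monotone (cellSum G N n) := fun _ _ h =>
  Finset.sum_le_sum fun k _ => floor_mul_monotone hm N k h

/-- For `s ≤ t` the sums compare term by term, so equality of the totals forces equality of every
floor: both points share a cell of length `1 / N` at each time. -/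
theorem abs_sub_le_of_cellSum_eq {N n : ℕ} (hN : 0 < N) {s t : ℝ}
    (h : cellSum G N n s = cellSum G N n t) {k : ℕ} (hk : k < n) :
    |G k s - G k t| ≤ 1 / N := by
  wlog hst : s ≤ t generalizing s t
  · rw [abs_sub_comm]
    exact this h.symm (le_of_not_ge hst)
  have hfl := (Finset.sum_eq_sum_iff_of_le fun k _ => floor_mul_monotone hm N k hst).1 h k
    (Finset.mem_range.2 hk)
  have hN' : (0 : ℝ) < N := by exact_mod_cast hN
  have hlt := Int.abs_sub_lt_one_of_floor_eq_floor hfl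
  rw [← mul_sub, abs_mul, abs_of_pos hN'] at hlt
  rw [le_div_iff₀ hN', mul_comm]
  exact hlt.le

theorem cellSum_mem_Icc (h1 : ∀ k t, G k (t + 1) = G k t + 1) (N n : ℕ) {t : ℝ}
    (ht : t ∈ Icc (0 : ℝ) 2) :
    cellSum G N n t ∈ Finset.Icc (cellSum G N n 0) (cellSum G N n 0 + 2 * N * n) := by
  rw [Finset.mem_Icc]
  refine ⟨cellSum_monotone hm N n ht.1, (cellSum_monotone hm N n ht.2).trans_eq ?_⟩
  -- Two turns raise each lift by exactly 2, hence each cell index by exactly `2 * N`.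
  have h2 : ∀ k, ⌊N * G k 2⌋ = ⌊N * G k 0⌋ + 2 * N := by
    intro k
    have : G k 2 = G k 0 + 2 := by
      rw [show (2 : ℝ) = 0 + 1 + 1 by norm_num, h1, h1]
      ring
    rw [this, mul_add, show (N : ℝ) * 2 = ((2 * N : ℤ) : ℝ) by push_cast; ring,
      Int.floor_add_intCast]
  simp only [cellSum, h2, Finset.sum_add_distrib, Finset.sum_const, Finset.card_range,
    nsmul_eq_mul]
  ring

end CellSum

/-! ### Zero entropy on subcontinua of the circle -/

/-- Each continuum is coded by the cell sums of its two endpoints. Equal codes keep the image arcs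
within `2π / N ≤ ε` at all times `k < n`, so the code is injective on a separated set. -/
theorem sepCard_continua_le (f : ℕ → C(Circle, Circle))
    (hor : ∀ n, OrientationPreserving (f n)) {N : ℕ} (hN : 0 < N) {ε : ℝ}
    (hε : 2 * Real.pi * (1 / N) ≤ ε) {n : ℕ} (hn : 0 < n) :
    sepCard (fun n => hyperMap (f n)) (continua Circle) n ε ≤
      ((((2 * N + 1) * n) ^ 2 : ℕ) : ℕ∞) := by
  choose G hGc hGm hG1 hG using fun k => OrientationPreserving.orbitMap hor k
  have harc : ∀ K : NonemptyCompacts Circle, ∃ q : ℝ × ℝ, K ∈ continua Circle →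
      0 ≤ q.1 ∧ q.1 ≤ q.2 ∧ q.2 ≤ 2 ∧ (K : Set Circle) = arc q.1 q.2 := by
    intro K
    by_cases hK : K ∈ continua Circle
    · obtain ⟨a, b, h⟩ := exists_eq_arc K.isCompact hK
      exact ⟨(a, b), fun _ => h⟩
    · exact ⟨0, fun h => absurd h hK⟩
  choose q hq using harc
  let J : Finset ℤ := Finset.Icc (cellSum G N n 0) (cellSum G N n 0 + 2 * N * n)
  have hJ : J.card = 2 * N * n + 1 := by
    rw [Int.card_Icc]
    have : cellSum G N n 0 + 2 * N * n + 1 - cellSum G N n 0 = ((2 * N * n + 1 : ℕ) : ℤ) := by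
      push_cast
      ring
    rw [this, Int.toNat_natCast]
  refine iSup_le fun E => iSup₂_le fun hE hs => ?_
  have hmaps : MapsTo (fun K => (cellSum G N n (q K).1, cellSum G N n (q K).2)) E
      ((J ×ˢ J : Finset (ℤ × ℤ)) : Set (ℤ × ℤ)) := by
    intro K hK
    obtain ⟨h0, h1, h2, -⟩ := hq K (hE hK)
    rw [Finset.mem_coe, Finset.mem_product]
    exact ⟨cellSum_mem_Icc hGm hG1 N n ⟨h0, h1.trans h2⟩,
      cellSum_mem_Icc hGm hG1 N n ⟨h0.trans h1, h2⟩⟩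
  have hinj : InjOn (fun K => (cellSum G N n (q K).1, cellSum G N n (q K).2)) E := by
    intro K hK L hL hKL
    by_contra hne
    obtain ⟨k, hk, hlt⟩ := hs K hK L hL hne
    obtain ⟨-, hKle, -, hKarc⟩ := hq K (hE hK)
    obtain ⟨-, hLle, -, hLarc⟩ := hq L (hE hL)
    rw [Prod.mk.injEq] at hKL
    refine hlt.not_ge (le_trans ?_ hε)
    rw [Metric.NonemptyCompacts.dist_eq, coe_orbitMap_hyperMap, coe_orbitMap_hyperMap, hKarc, hLarc,
      image_arc (hGc k) (hGm k) (hG k) hKle, image_arc (hGc k) (hGm k) (hG k) hLle]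
    exact hausdorffDist_arc_le (hGm k hKle) (hGm k hLle)
      (abs_sub_le_of_cellSum_eq hGm hN hKL.1 hk) (abs_sub_le_of_cellSum_eq hGm hN hKL.2 hk)
  refine (encard_le_encard_of_injOn hmaps hinj).trans ?_
  rw [encard_coe_eq_coe_finsetCard, Finset.card_product, hJ, Nat.cast_le, ← sq]
  -- As `n ≥ 1`, `2Nn + 1 ≤ (2N + 1)n`, the form `C * n` expected by
  -- `topEntropy_nonpos_of_sepCard_le`.
  refine Nat.pow_le_pow_left ?_ 2
  rw [add_mul, one_mul]
  exact Nat.add_le_add_left hn _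

theorem topEntropy_hyperMap_continua_nonpos (f : ℕ → C(Circle, Circle))
    (hor : ∀ n, OrientationPreserving (f n)) :
    topEntropy (fun n => hyperMap (f n)) (continua Circle) ≤ 0 := by
  refine topEntropy_nonpos_of_sepCard_le _ _ fun ε hε => ?_
  obtain ⟨m, hm⟩ := exists_nat_one_div_lt (div_pos hε Real.two_pi_pos)
  refine ⟨2 * (m + 1) + 1, Nat.succ_pos _, fun n hn =>
    sepCard_continua_le f hor (Nat.succ_pos m) ?_ hn⟩
  rw [lt_div_iff₀ Real.two_pi_pos, mul_comm] at hm
  push_cast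
  exact hm.le

theorem continua_nonempty (X : Type*) [MetricSpace X] [Nonempty X] : (continua X).Nonempty :=
  ⟨{Classical.arbitrary X}, by simpa [continua] using isConnected_singleton⟩

end NonautonomousSystem

theorem mainTheorem2 (f : ℕ → C(Circle, Circle))
    (hequi : UniformEquicontinuous (fun n => (f n : Circle → Circle)))
    (hor : ∀ n, NonautonomousSystem.OrientationPreserving (f n)) :
    NonautonomousSystem.topEntropy (fun n => (f n : Circle → Circle)) Set.univ = 0 ∧
    ((∀ n, Set.MapsTo (NonautonomousSystem.hyperMap (f n))
        (NonautonomousSystem.continua Circle) (NonautonomousSystem.continua Circle)) ∧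
      NonautonomousSystem.topEntropy (fun n => NonautonomousSystem.hyperMap (f n))
        (NonautonomousSystem.continua Circle) = 0) ∧
    ((∀ n, Set.MapsTo (NonautonomousSystem.FuzzySet.zadeh (f n))
        (NonautonomousSystem.fuzzyContinua Circle) (NonautonomousSystem.fuzzyContinua Circle)) ∧
      NonautonomousSystem.topEntropy (fun n => NonautonomousSystem.FuzzySet.zadeh (f n))
        (NonautonomousSystem.fuzzyContinua Circle) = 0) := by
  have h0 := NonautonomousSystem.topEntropy_hyperMap_continua_nonpos f hor
  have hne := NonautonomousSystem.continua_nonempty Circle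
  exact ⟨le_antisymm ((NonautonomousSystem.topEntropy_le_topEntropy_hyperMap f).trans h0)
      (NonautonomousSystem.topEntropy_nonneg _ Set.univ_nonempty),
    ⟨fun n => NonautonomousSystem.mapsTo_hyperMap_continua (f n),
      le_antisymm h0 (NonautonomousSystem.topEntropy_nonneg _ hne)⟩,
    ⟨fun n => NonautonomousSystem.mapsTo_zadeh_fuzzyContinua (f n),
      le_antisymm ((NonautonomousSystem.topEntropy_zadeh_le_topEntropy_hyperMap f).trans h0)
        (NonautonomousSystem.topEntropy_nonneg _ (hne.image _))⟩⟩
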